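/- Identify a set of natural numbers with its characteristic function in Cantor space $2^\omega$; $[\sigma]$ is the set of all $X\in 2^\omega$ extending the finite binary string $\sigma$, and $X\oplus Y$ is the join of $X$ and $Y$. For a Borel probability measure $\mu$ on $2^\omega$, a real $R\in 2^\omega$ is a \emph{representation} of $\mu$ if it codes a fast Cauchy sequence of basic measures converging to $\mu$; precisely: for each $n$ and $i<2^n$ let $\tau_{n,i}$ be the string of length $n$ with bits $\tau_{n,i}(j)=R(\langle n,\langle i,j\rangle\rangle)$ (where $\langle\cdot,\cdot\rangle$ is a fixed computable pairing function), and let $\nu_n^R=2^{-n}\sum_{i<2^n}\delta_{\tau_{n,i}0^\infty}$; then $R$ represents $\mu$ if $\sup_\sigma 2^{-|\sigma|}\,|\nu^R_n[\sigma]-\mu[\sigma]|\le 2^{-n}$ for all $n$. Let $\operatorname{MLR}_{\mu\times\mu}$ be the set of pairs $(X,Y)$ for which there is a representation $R$ of $\mu$ such that $(X,Y)\notin\bigcap_n V_n$ for every sequence $(V_n)$ of uniformly $\Sigma^0_1(R)$ subclasses of $2^\omega\times 2^\omega$ with $(\mu\times\mu)(V_n)\le 2^{-n}$ for all $n$. Let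 $\operatorname{MLR}_\mu(Z)$ be the set of $X\in 2^\omega$ for which there is a representation $R$ of $\mu$ such that $X\notin\bigcap_n V_n$ for every sequence $(V_n)$ of uniformly $\Sigma^0_1(R\oplus Z)$ subclasses of $2^\omega$ with $\mu(V_n)\le 2^{-n}$ for all $n$. The reals $A$ and $B$ are \emph{relatively random with respect to $\mu$} if $A\in\operatorname{MLR}_\mu(B)$ and $B\in\operatorname{MLR}_\mu(A)$. The \emph{independence spectrum} of $A$ is $$\mathcal R(A)=\{B\in 2^\omega : \text{there is a Borel probability measure } \mu \text{ on } 2^\omega \text{ with } (A,B)\in \operatorname{MLR}_{\mu\times\mu}\text{ and } \mu\{A,B\}=0\}.$$ \textbf{Corollary.} If $A$ is recursively enumerable and $B\le_{\mathrm T}\emptyset'$, then $B\notin\mathcal R(A)$. Likewise, there is no Borel probability measure $\mu$ on $2^\omega$ with $\mu\{A,B\}=0$ such that $A$ and $B$ are relatively random with respect to $\mu$. -/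

import Mathlib

noncomputable section

namespace IndepSpec

open MeasureTheory
open scoped ENNReal Computability

/-- Cantor space `2^ω`, with its product topology and product (= Borel) σ-algebra.  A real is also
regarded as the set of natural numbers of which it is the characteristic function. -/
abbrev Cantor : Type := ℕ → Bool

/-- The basic clopen set `[σ]` of all reals that extend the finite string `σ`. -/
def cyl (σ : List Bool) : Set Cantor :=
  {X | ∀ (i : ℕ) (h : i < σ.length), X i = σ[i]}

/-! ### Computability -/

/-- The characteristic function of a real, in the form in which it is used as an oracle. -/
def charFun (X : Cantor) : ℕ →. ℕ := fun n => Part.some (X n).toNat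

/-- The join `X ⊕ Y`: `X` on the even numbers and `Y` on the odd numbers. -/
def join (X Y : Cantor) : Cantor :=
  fun n => if n % 2 = 0 then X (n / 2) else Y (n / 2)

/-- The empty set as a real. -/
def emptyReal : Cantor := fun _ => false

open Classical in
/-- The halting problem `∅'`, i.e. the set of all `e` such that the `e`-th partial recursive
function is defined at `e`. -/
def zeroJump : Cantor :=
  fun e => decide ((Nat.Partrec.Code.eval (Denumerable.ofNat Nat.Partrec.Code e) e).Dom)

/-- The real `A`, viewed as a set of natural numbers, is recursively enumerable. -/
def IsRE (A : Cantor) : Prop := REPred fun n : ℕ => A n = true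

/-- `X ≤_T Y`. -/
def TuringLE (X Y : Cantor) : Prop := charFun X ≤ᵀ charFun Y

/-- The predicate `p` is recursively enumerable in the oracle `Z`: it is the domain of a partial
function that is recursive in `Z` (the relativization of Mathlib's `REPred`). -/
def REPredIn {α : Type*} [Primcodable α] (Z : Cantor) (p : α → Prop) : Prop :=
  RecursiveIn {charFun Z} fun a => Part.assert (p a) fun _ => Part.some ()

/-- `(V n)` is a sequence of uniformly `Σ⁰₁(Z)` subclasses of `2^ω`. -/
def UniformlySigma01 (Z : Cantor) (V : ℕ → Set Cantor) : Prop :=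
  ∃ W : ℕ → Set (List Bool),
    REPredIn Z (fun p : ℕ × List Bool => p.2 ∈ W p.1) ∧
    ∀ n, V n = ⋃ σ ∈ W n, cyl σ

/-- `(V n)` is a sequence of uniformly `Σ⁰₁(Z)` subclasses of `2^ω × 2^ω`. -/
def UniformlySigma01Pair (Z : Cantor) (V : ℕ → Set (Cantor × Cantor)) : Prop :=
  ∃ W : ℕ → Set (List Bool × List Bool),
    REPredIn Z (fun p : ℕ × (List Bool × List Bool) => p.2 ∈ W p.1) ∧
    ∀ n, V n = ⋃ s ∈ W n, cyl s.1 ×ˢ cyl s.2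

/-! ### Representations of measures -/

/-- A metric on the Borel probability measures on Cantor space that is complete and compatible with
the weak-* topology:  `d(μ, ν) = sup_σ 2^{-|σ|} |μ[σ] - ν[σ]|`. -/
def cylDist (μ ν : Measure Cantor) : ℝ :=
  ⨆ σ : List Bool, (1 / 2 : ℝ) ^ σ.length * |μ.real (cyl σ) - ν.real (cyl σ)|

/-- The `i`-th atom of the `n`-th basic measure coded by `R`: a string of `n` bits of `R`, followed
by zeros. -/
def atomOf (R : Cantor) (n i : ℕ) : Cantor :=
  fun j => if j < n then R (Nat.pair n (Nat.pair i j)) else false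

/-- The `n`-th basic measure coded by `R`: the average of `2^n` Dirac measures at reals of the form
`τ0^∞` with `|τ| = n`, a finite rational convex combination of Dirac measures.  For each `n` these
measures form a finite `2^{-n}`-net of the probability measures with respect to `cylDist`. -/
def basicMeasure (R : Cantor) (n : ℕ) : Measure Cantor :=
  ∑ i ∈ Finset.range (2 ^ n), ((2 : ℝ≥0∞)⁻¹ ^ n) • Measure.dirac (atomOf R n i)

/-- `R` is a representation of `μ`: the sequence of basic measures coded by `R` is a (fast) Cauchy
sequence with limit `μ`.  Every `R` represents at most one probability measure, every probability
measure has a representation, and as each entry of the sequence is chosen from a finite set, the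
representations of the measure represented by `R` form a `Π⁰₁(R)` class. -/
def Represents (R : Cantor) (μ : ProbabilityMeasure Cantor) : Prop :=
  ∀ n, cylDist (basicMeasure R n) (μ : Measure Cantor) ≤ (1 / 2 : ℝ) ^ n

/-! ### Randomness -/

/-- `(V n)` is an `(R, A)`-test for `μ`, where `R` is a representation of `μ`. -/
def IsTest (μ : ProbabilityMeasure Cantor) (R A : Cantor) (V : ℕ → Set Cantor) : Prop :=
  UniformlySigma01 (join R A) V ∧ ∀ n, (μ : Measure Cantor) (V n) ≤ (2 : ℝ≥0∞)⁻¹ ^ n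

/-- `MLR_μ(A)`: the reals that, for some representation `R` of `μ`, pass all `(R, A)`-tests. -/
def MLR (μ : ProbabilityMeasure Cantor) (A : Cantor) : Set Cantor :=
  {X | ∃ R, Represents R μ ∧ ∀ V, IsTest μ R A V → X ∉ ⋂ n, V n}

/-- `A` and `B` are relatively random with respect to `μ`. -/
def RelativelyRandom (μ : ProbabilityMeasure Cantor) (A B : Cantor) : Prop :=
  A ∈ MLR μ B ∧ B ∈ MLR μ A

/-- `(V n)` is an `(R, ∅)`-test on `2^ω × 2^ω` for `μ × μ`, where `R` is a representation of `μ`. -/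
def IsPairTest (μ : ProbabilityMeasure Cantor) (R : Cantor) (V : ℕ → Set (Cantor × Cantor)) :
    Prop :=
  UniformlySigma01Pair (join R emptyReal) V ∧
    ∀ n, ((μ : Measure Cantor).prod (μ : Measure Cantor)) (V n) ≤ (2 : ℝ≥0∞)⁻¹ ^ n

/-- `MLR_{μ × μ}`: the pairs that, for some representation `R` of `μ`, pass all `R`-tests on
`2^ω × 2^ω` for the product measure. -/
def MLRPair (μ : ProbabilityMeasure Cantor) : Set (Cantor × Cantor) :=
  {P | ∃ R, Represents R μ ∧ ∀ V, IsPairTest μ R V → P ∉ ⋂ n, V n}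

/-- The independence spectrum of `A`: all `B` such that for some Borel probability measure `μ` on
Cantor space, `(A, B)` is `μ × μ`-random and neither `A` nor `B` is an atom of `μ`. -/
def independenceSpectrum (A : Cantor) : Set Cantor :=
  {B | ∃ μ : ProbabilityMeasure Cantor, (A, B) ∈ MLRPair μ ∧ (μ : Measure Cantor) {A, B} = 0}

end IndepSpec

end

noncomputable section

attribute [fun_prop] Primrec PrimrecPred

namespace IndepSpec

open MeasureTheory
open scoped ENNReal Computability

section Computability

variable {α β γ : Type*} [Primcodable α] [Primcodable β] [Primcodable γ]

/-! ### Automation for primitive recursive functions and predicates -/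

section PrimrecRules

variable {f g : α → ℕ} {p q : α → Prop}

/-! Fix computable approximations: `As`, increasing to the r.e. set `A`, and `Bs`, converging to `B`
by the limit lemma. Given `μ` with `μ {A, B} = 0`, compare the speeds of the two approximations. Let
`c(n)` be the first stage from `n` on at which `Bs` is correct up to `n`; it is found from `B`
restricted to `n`.

Either, for infinitely many `n`, stage `c(n)` of `As` is already correct on an initial segment of
`A` of measure below `2⁻ⁿ` (`SettlesFirst`). Then `B` restricted to `n` yields one string of measure
below `2⁻ⁿ` that `A` extends, namely the shortest such initial segment of `As` at that stage. The
tails over `n > N` form a test (`stageTest`) that captures `A` relative to `B`.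

Or this fails for all `n > N`. If `A` agrees with `As` at stage `s` on a string of measure below
`2⁻ᵐ`, where `m > N`, then `s > c(m)`: otherwise stage `c(m)`, lying between `As s` and `A`, would
also be correct on that string. So if `Bs` is constant up to `j ≤ m` on the stages from `m` to `s`,
its value there is that of `B`. Hence `A` predicts initial segments of `B`; they can be taken of
arbitrarily small measure because neither real is an atom. Using the least verified guess makes the
prediction a single cylinder (`guessTest`), which captures `B` relative to `A`.

Both tests are open sets of pairs whose sections, in one direction, are small uniformly. Freezing
the other coordinate gives a test for relative randomness, and Fubini gives one for `μ × μ`.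
Measures of cylinders are approximated from a representation `R`; since the dichotomy does not
mention `R`, every representation is defeated. -/

@[fun_prop] theorem primrec_id : Primrec (fun x : α => x) := Primrec.id

@[fun_prop] theorem primrec_const (b : β) : Primrec (fun _ : α => b) := Primrec.const b

@[fun_prop] theorem primrec_comp {f : β → γ} {g : α → β} (hf : Primrec f) (hg : Primrec g) :
    Primrec (fun x => f (g x)) := hf.comp hg

@[fun_prop] theorem primrec_fst {f : α → β × γ} (hf : Primrec f) : Primrec (fun x => (f x).1) :=
  Primrec.fst.comp hf

@[fun_prop] theorem primrec_snd {f : α → β × γ} (hf : Primrec f) : Primrec (fun x => (f x).2) :=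
  Primrec.snd.comp hf

@[fun_prop] theorem primrec_mk {f : α → β} {g : α → γ} (hf : Primrec f) (hg : Primrec g) :
    Primrec (fun x => (f x, g x)) := hf.pair hg

@[fun_prop] theorem primrec_add (hf : Primrec f) (hg : Primrec g) :
    Primrec (fun x => f x + g x) := Primrec.nat_add.comp hf hg

@[fun_prop] theorem primrec_mul (hf : Primrec f) (hg : Primrec g) :
    Primrec (fun x => f x * g x) := Primrec.nat_mul.comp hf hg

@[fun_prop] theorem primrec_pow (hf : Primrec f) (hg : Primrec g) :
    Primrec (fun x => f x ^ g x) :=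
  (Primrec₂.unpaired'.1 Nat.Primrec.pow).comp hf hg

@[fun_prop] theorem primrec_natPair (hf : Primrec f) (hg : Primrec g) :
    Primrec (fun x => Nat.pair (f x) (g x)) := Primrec₂.natPair.comp hf hg

@[fun_prop] theorem primrec_unpair (hf : Primrec f) : Primrec (fun x => Nat.unpair (f x)) :=
  Primrec.unpair.comp hf

@[fun_prop] theorem primrec_listLength {f : α → List β} (hf : Primrec f) :
    Primrec (fun x => (f x).length) := Primrec.list_length.comp hf

@[fun_prop] theorem primrec_listRange (hf : Primrec f) :
    Primrec (fun x => List.range (f x)) := Primrec.list_range.comp hf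

@[fun_prop] theorem primrec_listTake {l : α → List β} (hf : Primrec f) (hl : Primrec l) :
    Primrec (fun x => (l x).take (f x)) := Primrec.list_take.comp hf hl

@[fun_prop] theorem primrec_listGetD {l : α → List β} {d : β} (hl : Primrec l) (hf : Primrec f) :
    Primrec (fun x => (l x).getD (f x) d) := (Primrec.list_getD d).comp hl hf

@[fun_prop] theorem primrec_listAppend {l m : α → List β} (hl : Primrec l) (hm : Primrec m) :
    Primrec (fun x => l x ++ m x) := Primrec.list_append.comp hl hm

@[fun_prop] theorem primrec_listCons {l : α → β} {m : α → List β} (hl : Primrec l)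
    (hm : Primrec m) : Primrec (fun x => l x :: m x) := Primrec.list_cons.comp hl hm

@[fun_prop] theorem primrec_ite {c : α → Prop} [DecidablePred c] {f g : α → β}
    (hc : PrimrecPred c) (hf : Primrec f) (hg : Primrec g) :
    Primrec (fun x => if c x then f x else g x) := Primrec.ite hc hf hg

@[fun_prop] theorem primrec_decide {c : α → Prop} [DecidablePred c] (hc : PrimrecPred c) :
    Primrec (fun x => decide (c x)) := hc.decide

@[fun_prop] theorem primrecPred_const (p : Prop) : PrimrecPred (fun _ : α => p) := by
  classical exact ⟨fun _ => inferInstance, Primrec.const _⟩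

@[fun_prop] theorem primrecPred_comp {p : β → Prop} {f : α → β} (hp : PrimrecPred p)
    (hf : Primrec f) : PrimrecPred (fun x => p (f x)) := hp.comp hf

@[fun_prop] theorem primrecPred_lt (hf : Primrec f) (hg : Primrec g) :
    PrimrecPred (fun x => f x < g x) := Primrec.nat_lt.comp hf hg

@[fun_prop] theorem primrecPred_le (hf : Primrec f) (hg : Primrec g) :
    PrimrecPred (fun x => f x ≤ g x) := Primrec.nat_le.comp hf hg

@[fun_prop] theorem primrecPred_eq {f g : α → β} (hf : Primrec f) (hg : Primrec g) :
    PrimrecPred (fun x => f x = g x) := Primrec.eq.comp hf hg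

@[fun_prop] theorem primrecPred_and (hp : PrimrecPred p) (hq : PrimrecPred q) :
    PrimrecPred (fun x => p x ∧ q x) := hp.and hq

@[fun_prop] theorem primrecPred_or (hp : PrimrecPred p) (hq : PrimrecPred q) :
    PrimrecPred (fun x => p x ∨ q x) := hp.or hq

@[fun_prop] theorem primrecPred_not (hp : PrimrecPred p) : PrimrecPred (fun x => ¬ p x) := hp.not

@[fun_prop] theorem primrecPred_imp (hp : PrimrecPred p) (hq : PrimrecPred q) :
    PrimrecPred (fun x => p x → q x) :=
  (hp.not.or hq).of_eq fun _ => imp_iff_not_or.symm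

@[fun_prop] theorem primrecPred_ball {p : α → ℕ → Prop}
    (hp : PrimrecPred fun x : α × ℕ => p x.1 x.2) (hf : Primrec f) :
    PrimrecPred (fun a => ∀ i < f a, p a i) :=
  ((PrimrecRel.forall_mem_list (R := fun (i : ℕ) (a : α) => p a i)
    (hp.comp (Primrec.snd.pair Primrec.fst))).comp (Primrec.list_range.comp hf) Primrec.id).of_eq
    fun a => by simp

@[fun_prop] theorem primrecPred_bex {p : α → ℕ → Prop}
    (hp : PrimrecPred fun x : α × ℕ => p x.1 x.2) (hf : Primrec f) :
    PrimrecPred (fun a => ∃ i < f a, p a i) :=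
  ((PrimrecRel.exists_mem_list (R := fun (i : ℕ) (a : α) => p a i)
    (hp.comp (Primrec.snd.pair Primrec.fst))).comp (Primrec.list_range.comp hf) Primrec.id).of_eq
    fun a => by simp

@[fun_prop] theorem primrec_listFilter {l : α → List β} {p : α → β → Prop}
    [∀ a b, Decidable (p a b)]
    (hl : Primrec l) (hp : PrimrecPred fun x : α × β => p x.1 x.2) :
    Primrec (fun x => (l x).filter (fun b => p x b)) := by
  have h : Primrec fun x => (l x).filterMap (fun b => if p x b then some b else none) := by
    refine Primrec.listFilterMap hl ?_
    exact Primrec.ite hp (Primrec.option_some.comp Primrec.snd) (Primrec.const none)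
  refine h.of_eq fun x => ?_
  rw [← List.filterMap_eq_filter]
  congr 1
  funext b
  simp [Option.guard]

end PrimrecRules

/-! ### Initial segments -/

/-- The initial segment of length `N` of a real. -/
def pre (X : Cantor) (N : ℕ) : List Bool := (List.range N).map X

@[simp] theorem length_pre (X : Cantor) (N : ℕ) : (pre X N).length = N := by simp [pre]

theorem getElem_pre (X : Cantor) (N i : ℕ) (h : i < (pre X N).length) : (pre X N)[i] = X i := by
  simp [pre]

theorem pre_eq_iff {X : Cantor} {N : ℕ} {σ : List Bool} :
    pre X N = σ ↔ N = σ.length ∧ X ∈ cyl σ := by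
  constructor
  · rintro rfl
    exact ⟨by simp, fun i h => (getElem_pre X N i h).symm⟩
  · rintro ⟨rfl, h⟩
    refine List.ext_getElem (by simp) fun i h1 h2 => ?_
    rw [getElem_pre, h i h2]

theorem mem_cyl_iff {X : Cantor} {σ : List Bool} : X ∈ cyl σ ↔ pre X σ.length = σ := by
  simp [pre_eq_iff]

theorem mem_cyl_pre {X Y : Cantor} {N : ℕ} : X ∈ cyl (pre Y N) ↔ pre X N = pre Y N := by
  simp [mem_cyl_iff]

theorem pre_eq_pre_iff {X Y : Cantor} {N : ℕ} : pre X N = pre Y N ↔ ∀ i < N, X i = Y i := by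
  simp [pre, List.map_inj_left]

theorem pre_mono {X Y : Cantor} {M N : ℕ} (h : M ≤ N) (e : pre X N = pre Y N) :
    pre X M = pre Y M :=
  pre_eq_pre_iff.2 fun i hi => pre_eq_pre_iff.1 e i (hi.trans_le h)

theorem take_pre (X : Cantor) {M N : ℕ} (h : M ≤ N) : (pre X N).take M = pre X M := by
  rw [pre, pre, ← List.map_take, List.take_range, min_eq_left h]

theorem pre_succ (X : Cantor) (N : ℕ) : pre X (N + 1) = pre X N ++ [X N] := by
  simp [pre, List.range_succ]

/-! ### Relations that are `Σ⁰₁` in an oracle -/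

/-- The predicate `p` is `Σ⁰₁` in the real `Z`, in normal form: a primitive recursive predicate
holds of some initial segment of `Z`, and then of all longer ones. -/
@[fun_prop]
def Sigma01 (Z : Cantor) (p : α → Prop) : Prop :=
  ∃ D : α × List Bool → Prop, PrimrecPred D ∧
    (∀ a M N, M ≤ N → D (a, pre Z M) → D (a, pre Z N)) ∧ ∀ a, p a ↔ ∃ N, D (a, pre Z N)

namespace Sigma01

variable {Z : Cantor} {p q : α → Prop}

theorem of_iff (h : Sigma01 Z p) (e : ∀ a, q a ↔ p a) : Sigma01 Z q := by
  rwa [show q = p from funext fun a => propext (e a)]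

@[fun_prop] theorem of_primrecPred (h : PrimrecPred p) : Sigma01 Z p :=
  ⟨fun x => p x.1, by fun_prop, fun _ _ _ _ => id, fun a => by simp⟩

@[fun_prop] theorem and (hp : Sigma01 Z p) (hq : Sigma01 Z q) :
    Sigma01 Z (fun x => p x ∧ q x) := by
  obtain ⟨D, hD, mD, eD⟩ := hp
  obtain ⟨E, hE, mE, eE⟩ := hq
  refine ⟨fun x => D x ∧ E x, by fun_prop, fun a M N h hx => ⟨mD a M N h hx.1, mE a M N h hx.2⟩,
    fun a => ?_⟩
  simp only [eD, eE]
  constructor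
  · rintro ⟨⟨M, hM⟩, N, hN⟩
    exact ⟨max M N, mD _ _ _ (le_max_left _ _) hM, mE _ _ _ (le_max_right _ _) hN⟩
  · rintro ⟨N, h1, h2⟩
    exact ⟨⟨N, h1⟩, N, h2⟩

@[fun_prop] theorem or (hp : Sigma01 Z p) (hq : Sigma01 Z q) :
    Sigma01 Z (fun x => p x ∨ q x) := by
  obtain ⟨D, hD, mD, eD⟩ := hp
  obtain ⟨E, hE, mE, eE⟩ := hq
  refine ⟨fun x => D x ∨ E x, by fun_prop, fun a M N h hx => hx.imp (mD a M N h) (mE a M N h),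
    fun a => ?_⟩
  simp only [eD, eE, exists_or]

@[fun_prop] theorem comp {p : β → Prop} {f : α → β} (hp : Sigma01 Z p) (hf : Primrec f) :
    Sigma01 Z (fun x => p (f x)) := by
  obtain ⟨D, hD, mD, eD⟩ := hp
  exact ⟨fun x => D (f x.1, x.2), by fun_prop, fun a => mD (f a), fun a => eD (f a)⟩

@[fun_prop] theorem exists_nat {p : α → ℕ → Prop} (hp : Sigma01 Z fun x : α × ℕ => p x.1 x.2) :
    Sigma01 Z (fun a => ∃ k, p a k) := by
  obtain ⟨D, hD, mD, eD⟩ := hp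
  -- Bounding the search by the length of the oracle segment keeps the matrix primitive recursive
  -- and monotone.
  refine ⟨fun x => ∃ k < x.2.length, D ((x.1, k), x.2), by fun_prop, ?_, fun a => ?_⟩
  · rintro a M N h ⟨k, hk, hx⟩
    exact ⟨k, by simp at hk ⊢; omega, mD _ _ _ h hx⟩
  · simp only [length_pre]
    constructor
    · rintro ⟨k, hk⟩
      obtain ⟨N, hN⟩ := (eD (a, k)).1 hk
      exact ⟨max N (k + 1), k, by omega, mD _ _ _ (le_max_left _ _) hN⟩
    · rintro ⟨N, k, -, h⟩
      exact ⟨k, (eD (a, k)).2 ⟨N, h⟩⟩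

theorem option_elim {o : α → Option β} {p : α → β → Prop} (ho : Primrec o)
    (hp : Sigma01 Z fun x : α × β => p x.1 x.2) : Sigma01 Z (fun a => ∃ b, o a = some b ∧ p a b) := by
  classical
  obtain ⟨D, hD, mD, eD⟩ := hp
  refine ⟨fun x => ∃ b, o x.1 = some b ∧ D ((x.1, b), x.2), ?_, ?_, fun a => ?_⟩
  · have h : Primrec fun x : α × List Bool =>
        Option.casesOn (motive := fun _ => Bool) (o x.1) false
          (fun b => decide (D ((x.1, b), x.2))) := by
      refine Primrec.option_casesOn (by fun_prop) (Primrec.const false) ?_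
      exact (show Primrec fun x : (α × List Bool) × β => decide (D ((x.1.1, x.2), x.1.2)) by fun_prop)
    refine (Primrec.primrecPred (p := fun x => _ = true) (by simpa using h)).of_eq fun x => ?_
    cases o x.1 <;> simp
  · rintro a M N h ⟨b, hb, hx⟩
    exact ⟨b, hb, mD _ _ _ h hx⟩
  · constructor
    · rintro ⟨b, hb, h⟩
      obtain ⟨N, h⟩ := (eD (a, b)).1 h
      exact ⟨N, b, hb, h⟩
    · rintro ⟨N, b, hb, h⟩
      exact ⟨b, hb, (eD (a, b)).2 ⟨N, h⟩⟩

@[fun_prop] theorem exists' {p : α → β → Prop} (hp : Sigma01 Z fun x : α × β => p x.1 x.2) :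
    Sigma01 Z (fun a => ∃ b, p a b) := by
  have h : Sigma01 Z (fun a => ∃ k : ℕ, ∃ b : β, Encodable.decode k = some b ∧ p a b) := by
    refine exists_nat (option_elim (p := fun (a : α × ℕ) (b : β) => p a.1 b) ?_ ?_)
    · exact Primrec.decode.comp Primrec.snd
    · fun_prop
  refine h.of_iff fun a => ⟨fun ⟨b, hb⟩ => ⟨Encodable.encode b, b, by simp, hb⟩, ?_⟩
  rintro ⟨k, b, -, hb⟩
  exact ⟨b, hb⟩

-- Finitely many instances need finitely many oracle segments, and by monotonicity the longest one
-- serves for all.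
@[fun_prop] theorem ball {p : α → ℕ → Prop} {f : α → ℕ}
    (hp : Sigma01 Z fun x : α × ℕ => p x.1 x.2) (hf : Primrec f) :
    Sigma01 Z (fun a => ∀ i < f a, p a i) := by
  obtain ⟨D, hD, mD, eD⟩ := hp
  refine ⟨fun x => ∀ i < f x.1, D ((x.1, i), x.2), by fun_prop, ?_, fun a => ?_⟩
  · exact fun a M N h hx i hi => mD _ _ _ h (hx i hi)
  · change (∀ i < f a, p a i) ↔ ∃ N, ∀ i < f a, D ((a, i), pre Z N)
    generalize f a = m
    induction m with
    | zero => simp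
    | succ m ih =>
      simp only [Nat.forall_lt_succ_right, ih, show p a m ↔ _ from eD (a, m)]
      constructor
      · rintro ⟨⟨M, hM⟩, N, hN⟩
        exact ⟨max M N, fun i hi => mD _ _ _ (le_max_left _ _) (hM i hi),
          mD _ _ _ (le_max_right _ _) hN⟩
      · rintro ⟨N, h1, h2⟩
        exact ⟨⟨N, h1⟩, N, h2⟩

theorem eq_bit (Z : Cantor) : Sigma01 Z (fun x : ℕ × Bool => Z x.1 = x.2) := by
  refine ⟨fun x => x.1.1 < x.2.length ∧ x.2.getD x.1.1 false = x.1.2, by fun_prop, ?_, ?_⟩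
  · rintro ⟨n, b⟩ M N h ⟨h1, h2⟩
    simp only [length_pre] at h1 ⊢
    have h1' : n < N := by omega
    refine ⟨h1', ?_⟩
    simpa [List.getD, pre, h1, h1'] using h2
  · rintro ⟨n, b⟩
    constructor
    · intro h
      exact ⟨n + 1, by simpa [pre] using h⟩
    · rintro ⟨N, h1, h2⟩
      simp only [length_pre] at h1
      simpa [List.getD, pre, h1] using h2

/-- The initial segments of a real computable from `Z` are `Σ⁰₁` in `Z`. -/
theorem eq_pre {R : Cantor} (h : Sigma01 Z (fun x : ℕ × Bool => R x.1 = x.2)) :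
    Sigma01 Z (fun ρ : List Bool => pre R ρ.length = ρ) := by
  have h' : Sigma01 Z (fun ρ : List Bool => ∀ i < ρ.length, R i = ρ.getD i false) :=
    ball (h.comp (f := fun x : List Bool × ℕ => (x.2, x.1.getD x.2 false)) (by fun_prop))
      (by fun_prop)
  refine h'.of_iff fun ρ => ?_
  rw [← mem_cyl_iff]
  exact forall₂_congr fun i hi => by simp [hi]

/-- Tests are built relative to any oracle that computes `R`; this supplies the oracles `R ⊕ ∅` and
`R ⊕ B` alike. -/
theorem eq_bit_join_left (R A : Cantor) :
    Sigma01 (join R A) (fun x : ℕ × Bool => R x.1 = x.2) :=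
  ((eq_bit (join R A)).comp (f := fun x : ℕ × Bool => (2 * x.1, x.2)) (by fun_prop)).of_iff
    fun x => by simp [join]

theorem eq_bit_join_right (R A : Cantor) :
    Sigma01 (join R A) (fun x : ℕ × Bool => A x.1 = x.2) :=
  ((eq_bit (join R A)).comp (f := fun x : ℕ × Bool => (2 * x.1 + 1, x.2)) (by fun_prop)).of_iff
    fun x => by
      simp [join, Nat.add_mod]
      grind

end Sigma01

/-! ### Comparison with oracle computability -/

theorem _root_.Primrec.natRecursiveIn {O : Set (ℕ →. ℕ)} {f : ℕ → ℕ} (hf : Primrec f) :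
    Nat.RecursiveIn O (fun n => Part.some (f n)) :=
  (Primrec.nat_iff.1 hf).recursiveIn

theorem recursiveIn_pre (Z : Cantor) :
    Nat.RecursiveIn {charFun Z} (fun p => Part.some (Encodable.encode (pre Z p.unpair.2))) := by
  let dec : ℕ → List Bool := fun i => (Encodable.decode (α := List Bool) i).getD []
  have hdec : Primrec dec := Primrec.option_getD.comp Primrec.decode (Primrec.const [])
  have horacle : Nat.RecursiveIn {charFun Z} (charFun Z) := .oracle _ rfl
  have hy : Nat.RecursiveIn {charFun Z} (fun q => Part.some q.unpair.2.unpair.1) :=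
    Primrec.natRecursiveIn (by fun_prop)
  have hid : Nat.RecursiveIn {charFun Z} (fun q => Part.some q) :=
    Primrec.natRecursiveIn (by fun_prop)
  have hcat : Nat.RecursiveIn {charFun Z} (fun q => Part.some
      (Encodable.encode (dec q.unpair.1.unpair.2.unpair.2 ++ [decide (q.unpair.2 = 1)]))) :=
    Primrec.natRecursiveIn (Primrec.encode.comp (by fun_prop))
  have hnil : Nat.RecursiveIn {charFun Z}
      (fun _ => Part.some (Encodable.encode ([] : List Bool))) :=
    Primrec.natRecursiveIn (by fun_prop)
  have hstep : Nat.RecursiveIn {charFun Z} (fun q => Part.some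
      (Encodable.encode (dec q.unpair.2.unpair.2 ++ [Z q.unpair.2.unpair.1]))) := by
    refine (hcat.comp (hid.pair (horacle.comp hy))).of_eq fun q => ?_
    have hq : (Part.some q.unpair.2.unpair.1 >>= charFun Z) =
        Part.some (Z q.unpair.2.unpair.1).toNat := Part.bind_some _ _
    rw [hq]
    cases Z q.unpair.2.unpair.1 <;> simp [Seq.seq]
  refine (Nat.RecursiveIn.prec hnil hstep).of_eq fun p => ?_
  simp only
  generalize p.unpair.2 = n
  induction n with
  | zero => simp [pre]
  | succ n ih =>
    refine (congrArg (Part.bind · _) ih).trans ?_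
    simp [pre_succ, dec]

/-- A predicate in normal form is recursively enumerable in the oracle. -/
theorem Sigma01.rePredIn {Z : Cantor} {p : α → Prop} (hp : Sigma01 Z p) : REPredIn Z p := by
  classical
  obtain ⟨D, hD, -, eD⟩ := hp
  let dec : ℕ → List Bool := fun i => (Encodable.decode (α := List Bool) i).getD []
  have hdec : Primrec dec := Primrec.option_getD.comp Primrec.decode (Primrec.const [])
  -- The value `0` signals success for `Nat.rfind`; inputs that code no element get `1`, so that the
  -- search diverges there.
  let t : ℕ → ℕ := fun q => Option.casesOn (motive := fun _ => ℕ)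
    (Encodable.decode (α := α) q.unpair.1.unpair.1) 1
    (fun a => if D (a, dec q.unpair.2) then 0 else 1)
  have ht : Primrec t := by
    refine Primrec.option_casesOn (Primrec.decode.comp (by fun_prop)) (Primrec.const 1) ?_
    exact (show Primrec fun x : ℕ × α => if D (x.2, dec x.1.unpair.2) then 0 else 1 by fun_prop)
  have hid : Nat.RecursiveIn {charFun Z} (fun q => Part.some q) :=
    Primrec.natRecursiveIn (by fun_prop)
  have h0 : Nat.RecursiveIn {charFun Z} (fun _ => Part.some 0) :=
    Primrec.natRecursiveIn (by fun_prop)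
  have hsearch : Nat.RecursiveIn {charFun Z}
      (fun q => Part.some (t (Nat.pair q (Encodable.encode (pre Z q.unpair.2))))) :=
    (ht.natRecursiveIn.comp (hid.pair (recursiveIn_pre Z))).of_eq fun q => by simp [Seq.seq]
  have htv : ∀ c n, t (Nat.pair (Nat.pair c n) (Encodable.encode (pre Z n))) = 0 ↔
      ∃ a : α, Encodable.decode c = some a ∧ D (a, pre Z n) := by
    intro c n
    simp only [t, dec, Nat.unpair_pair, Encodable.encodek, Option.getD_some]
    cases Encodable.decode (α := α) c <;> simp
  refine (h0.comp hsearch.rfind).of_eq fun c => Part.ext fun m => ?_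
  have hr : ∀ x : Part ℕ, m ∈ (x >>= fun _ => Part.some 0) ↔ x.Dom ∧ m = 0 := by
    intro x
    simp [Part.dom_iff_mem]
  refine (hr _).trans ?_
  have hdom : (Nat.rfind fun n => (fun m => decide (m = 0)) <$>
      Part.some (t (Nat.pair (Nat.pair c n)
        (Encodable.encode (pre Z (Nat.pair c n).unpair.2))))).Dom ↔
      ∃ a : α, Encodable.decode c = some a ∧ p a := by
    refine Nat.rfind_dom.trans ?_
    simp only [Nat.unpair_pair, Part.map_eq_map, Part.map_some, Part.mem_some_iff, true_eq_decide_iff, htv,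
      Part.some_dom, implies_true, and_true, eD]
    grind
  refine (and_congr_left' hdom).trans ?_
  cases hc : Encodable.decode (α := α) c <;> simp [Part.mem_assert_iff, Unique.exists_iff, and_comm, eq_comm (a := m)]

/-- The graph of a function recursive in `Z` is `Σ⁰₁` in `Z`. -/
theorem sigma01_graph {Z : Cantor} {f : ℕ →. ℕ} (hf : Nat.RecursiveIn {charFun Z} f) :
    Sigma01 Z (fun x : ℕ × ℕ => x.2 ∈ f x.1) := by
  induction hf with
  | zero =>
    exact Sigma01.of_iff (p := fun x : ℕ × ℕ => x.2 = 0) (by fun_prop) fun x => Part.mem_some_iff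
  | succ =>
    exact Sigma01.of_iff (p := fun x : ℕ × ℕ => x.2 = x.1 + 1) (by fun_prop)
      fun x => Part.mem_some_iff
  | left =>
    exact Sigma01.of_iff (p := fun x : ℕ × ℕ => x.2 = x.1.unpair.1) (by fun_prop)
      fun x => Part.mem_some_iff
  | right =>
    exact Sigma01.of_iff (p := fun x : ℕ × ℕ => x.2 = x.1.unpair.2) (by fun_prop)
      fun x => Part.mem_some_iff
  | oracle g hg =>
    obtain rfl : g = charFun Z := hg
    have h := Sigma01.eq_bit Z
    -- The oracle answers `0` or `1`; the bound `x.2 < 2` excludes the other numbers that `decide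
    -- (x.2 = 1)` sends to `false`.
    refine Sigma01.of_iff (p := fun x : ℕ × ℕ => Z x.1 = decide (x.2 = 1) ∧ x.2 < 2) ?_ ?_
    · exact (h.comp (f := fun x : ℕ × ℕ => (x.1, decide (x.2 = 1))) (by fun_prop)).and (by fun_prop)
    · intro x
      refine Part.mem_some_iff.trans ?_
      cases Z x.1 <;> simp <;> omega
  | @pair f h _ _ ihf ihh =>
    refine Sigma01.of_iff (p := fun x : ℕ × ℕ => x.2.unpair.1 ∈ f x.1 ∧ x.2.unpair.2 ∈ h x.1)
      ?_ fun x => ?_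
    · exact (ihf.comp (f := fun x : ℕ × ℕ => (x.1, x.2.unpair.1)) (by fun_prop)).and
        (ihh.comp (f := fun x : ℕ × ℕ => (x.1, x.2.unpair.2)) (by fun_prop))
    · simp only [Seq.seq, Part.map_eq_map, Part.mem_bind_iff, Part.mem_map_iff]
      constructor
      · rintro ⟨_, ⟨a, ha, rfl⟩, b, hb, e⟩
        rw [← e]
        simpa using ⟨ha, hb⟩
      · rintro ⟨h1, h2⟩
        exact ⟨_, ⟨_, h1, rfl⟩, _, h2, by simp⟩
  | @comp f h _ _ ihf ihh =>
    refine Sigma01.of_iff (p := fun x : ℕ × ℕ => ∃ z, z ∈ h x.1 ∧ x.2 ∈ f z) ?_ fun x => ?_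
    · refine Sigma01.exists_nat ?_
      exact (ihh.comp (f := fun x : (ℕ × ℕ) × ℕ => (x.1.1, x.2)) (by fun_prop)).and
        (ihf.comp (f := fun x : (ℕ × ℕ) × ℕ => (x.2, x.1.2)) (by fun_prop))
    · exact Part.mem_bind_iff
  | @prec f h _ _ ihf ihh =>
    -- `L` lists the values of the recursion. Its length is left free: a default `0` read past the
    -- end must satisfy the same conditions.
    refine Sigma01.of_iff (p := fun x : ℕ × ℕ => ∃ L : List ℕ, L.getD 0 0 ∈ f x.1.unpair.1 ∧
      (∀ i < x.1.unpair.2, L.getD (i + 1) 0 ∈ h (Nat.pair x.1.unpair.1 (Nat.pair i (L.getD i 0)))) ∧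
      L.getD x.1.unpair.2 0 = x.2) ?_ fun x => ?_
    · refine Sigma01.exists' (Sigma01.and ?_ (Sigma01.and (Sigma01.ball ?_ ?_) ?_))
      · exact ihf.comp (f := fun x : (ℕ × ℕ) × List ℕ => (x.1.1.unpair.1, x.2.getD 0 0))
          (by fun_prop)
      · exact ihh.comp (f := fun x : ((ℕ × ℕ) × List ℕ) × ℕ =>
          (Nat.pair x.1.1.1.unpair.1 (Nat.pair x.2 (x.1.2.getD x.2 0)), x.1.2.getD (x.2 + 1) 0))
          (by fun_prop)
      · fun_prop
      · fun_prop
    · obtain ⟨c, y⟩ := x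
      simp only
      generalize c.unpair.1 = a
      generalize c.unpair.2 = n
      constructor
      · intro hy
        -- Fixing the length lets the induction append the next value at the right position.
        suffices H : ∃ L : List ℕ, L.length = n + 1 ∧ L.getD 0 0 ∈ f a ∧
            (∀ i < n, L.getD (i + 1) 0 ∈ h (Nat.pair a (Nat.pair i (L.getD i 0)))) ∧
            L.getD n 0 = y by
          obtain ⟨L, -, H⟩ := H
          exact ⟨L, H⟩
        induction n generalizing y with
        | zero => exact ⟨[y], by simpa using hy⟩
        | succ n ih =>
          obtain ⟨z, hz, hy⟩ := Part.mem_bind_iff.1 hy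
          obtain ⟨L, hl, h0, hs, rfl⟩ := ih z hz
          have hg : ∀ i ≤ n, (L ++ [y]).getD i 0 = L.getD i 0 := fun i hi =>
            List.getD_append _ _ _ _ (by omega)
          have hg' : (L ++ [y]).getD (n + 1) 0 = y := by
            rw [List.getD_append_right _ _ _ _ (by omega)]
            simp [hl]
          refine ⟨L ++ [y], by simp [hl], by rwa [hg 0 (by omega)], fun i hi => ?_, hg'⟩
          rcases Nat.lt_succ_iff_lt_or_eq.1 hi with hi | rfl
          · rw [hg _ (by omega), hg _ hi]
            exact hs i hi
          · rw [hg', hg _ le_rfl]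
            exact hy
      · rintro ⟨L, h0, hs, rfl⟩
        induction n with
        | zero => exact h0
        | succ n ih =>
          exact Part.mem_bind_iff.2 ⟨_, ih fun i hi => hs i (by omega), hs n (by omega)⟩
  | @rfind f _ ihf =>
    refine Sigma01.of_iff (p := fun x : ℕ × ℕ => 0 ∈ f (Nat.pair x.1 x.2) ∧
      ∀ i < x.2, ∃ v, v + 1 ∈ f (Nat.pair x.1 i)) ?_ fun x => ?_
    · refine Sigma01.and ?_ (Sigma01.ball (Sigma01.exists_nat ?_) ?_)
      · exact ihf.comp (f := fun x : ℕ × ℕ => (Nat.pair x.1 x.2, 0)) (by fun_prop)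
      · exact ihf.comp (f := fun x : ((ℕ × ℕ) × ℕ) × ℕ => (Nat.pair x.1.1.1 x.1.2, x.2 + 1))
          (by fun_prop)
      · fun_prop
    · refine Nat.mem_rfind.trans ?_
      simp only [Part.map_eq_map, Part.mem_map_iff, exists_eq_right,
        decide_eq_true_eq, decide_eq_false_iff_not]
      refine and_congr (by simp) (forall_congr' fun i => imp_congr_right fun _ => ?_)
      constructor
      · rintro ⟨v, hv, hne⟩
        exact ⟨v - 1, by rwa [Nat.sub_add_cancel (by grind)]⟩
      · rintro ⟨v, hv⟩
        exact ⟨v + 1, hv, by simp⟩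

/-! ### Computable approximations -/

/-- The reals `X s` converge pointwise to `Y`. -/
def ConvergesTo (X : ℕ → Cantor) (Y : Cantor) : Prop :=
  ∀ N, ∃ s₀, ∀ s ≥ s₀, pre (X s) N = pre Y N

theorem ConvergesTo.of_forall {X : ℕ → Cantor} {Y : Cantor}
    (h : ∀ n, ∃ s₀, ∀ s ≥ s₀, X s n = Y n) : ConvergesTo X Y := by
  intro N
  choose g hg using h
  refine ⟨(Finset.range N).sup g, fun s hs => pre_eq_pre_iff.2 fun i hi => hg i s ?_⟩
  exact (Finset.le_sup (Finset.mem_range.2 hi)).trans hs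

theorem primrec_evaln_isSome {f g : α → ℕ} {c : α → Nat.Partrec.Code} (hf : Primrec f)
    (hc : Primrec c) (hg : Primrec g) :
    Primrec fun a => (Nat.Partrec.Code.evaln (f a) (c a) (g a)).isSome :=
  Primrec.option_isSome.comp
    (Nat.Partrec.Code.primrec_evaln.comp ((hf.pair hc).pair hg))

theorem isSome_evaln_mono {s t n : ℕ} {c : Nat.Partrec.Code} (h : s ≤ t)
    (hs : (Nat.Partrec.Code.evaln s c n).isSome) : (Nat.Partrec.Code.evaln t c n).isSome := by
  obtain ⟨x, hx⟩ := Option.isSome_iff_exists.1 hs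
  exact Option.isSome_iff_exists.2 ⟨x, Nat.Partrec.Code.evaln_mono h hx⟩

theorem exists_isSome_evaln_iff {n : ℕ} {c : Nat.Partrec.Code} :
    (∃ s, (Nat.Partrec.Code.evaln s c n).isSome) ↔ (c.eval n).Dom := by
  rw [Part.dom_iff_mem]
  simp only [Nat.Partrec.Code.evaln_complete, Option.isSome_iff_exists]
  exact exists_comm

theorem ConvergesTo.of_mono {X : ℕ → Cantor} {Y : Cantor}
    (hm : ∀ s t n, s ≤ t → X s n = true → X t n = true)
    (h : ∀ n, (∃ s, X s n = true) ↔ Y n = true) : ConvergesTo X Y := by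
  refine .of_forall fun n => ?_
  by_cases hY : Y n = true
  · obtain ⟨s₀, h₀⟩ := (h n).2 hY
    exact ⟨s₀, fun s hs => by rw [hY, hm _ _ _ hs h₀]⟩
  · refine ⟨0, fun s _ => ?_⟩
    have : ¬ X s n = true := fun hs => hY ((h n).1 ⟨s, hs⟩)
    simp_all

/-- An r.e. set is the limit of a computable increasing sequence. -/
theorem IsRE.exists_approximation {A : Cantor} (hA : IsRE A) :
    ∃ X : ℕ → Cantor, (Primrec fun p : ℕ × ℕ => X p.1 p.2) ∧ ConvergesTo X A ∧
      (∀ s t n, s ≤ t → X s n = true → X t n = true) ∧ ∀ s n, X s n = true → A n = true := by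
  obtain ⟨c, hc⟩ := Nat.Partrec.Code.exists_code.1
    (Partrec.nat_iff.1 ((show Partrec _ from hA).map (Computable.const 0).to₂))
  have hdom : ∀ n, (c.eval n).Dom ↔ A n = true := by
    intro n
    rw [hc]
    simp [Part.assert]
  have hlim : ∀ n, (∃ s, (Nat.Partrec.Code.evaln s c n).isSome = true) ↔ A n = true := fun n =>
    exists_isSome_evaln_iff.trans (hdom n)
  refine ⟨fun s n => (Nat.Partrec.Code.evaln s c n).isSome,
    primrec_evaln_isSome Primrec.fst (Primrec.const c) Primrec.snd,
    .of_mono (fun s t n h => isSome_evaln_mono h) hlim,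
    fun s t n h => isSome_evaln_mono h, fun s n h => (hlim n).1 ⟨s, h⟩⟩

theorem zeroJump_exists_approximation :
    ∃ X : ℕ → Cantor, (Primrec fun p : ℕ × ℕ => X p.1 p.2) ∧ ConvergesTo X zeroJump := by
  refine ⟨fun s e => (Nat.Partrec.Code.evaln s (Denumerable.ofNat _ e) e).isSome,
    primrec_evaln_isSome Primrec.fst ((Primrec.ofNat _).comp Primrec.snd) Primrec.snd,
    .of_mono (fun s t n h => isSome_evaln_mono h) fun n => ?_⟩
  rw [exists_isSome_evaln_iff]
  simp [zeroJump]

@[fun_prop] theorem primrec_pre {X : ℕ → Cantor} (hX : Primrec fun p : ℕ × ℕ => X p.1 p.2)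
    {f g : α → ℕ} (hf : Primrec f) (hg : Primrec g) : Primrec fun a => pre (X (f a)) (g a) := by
  unfold pre
  have := hX.comp (g := fun p : α × ℕ => (f p.1, p.2)) (by fun_prop)
  exact Primrec.list_map (by fun_prop) this

/-- The limit lemma: a set computable from the halting problem is the limit of a computable
sequence. -/
theorem TuringLE.exists_approximation {B : Cantor} (hB : TuringLE B zeroJump) :
    ∃ X : ℕ → Cantor, (Primrec fun p : ℕ × ℕ => X p.1 p.2) ∧ ConvergesTo X B := by
  classical
  obtain ⟨Z, hZ, lZ⟩ := zeroJump_exists_approximation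
  obtain ⟨D, hD, -, eD⟩ := sigma01_graph (RecursiveIn.iff_nat.1 hB)
  have h1 : ∀ n, B n = true ↔ ∃ N, D ((n, 1), pre zeroJump N) := by
    intro n
    rw [← eD (n, 1)]
    refine Iff.trans ?_ Part.mem_some_iff.symm
    cases B n <;> simp
  have h0 : ∀ n, B n = false ↔ ∃ N, D ((n, 0), pre zeroJump N) := by
    intro n
    rw [← eD (n, 0)]
    refine Iff.trans ?_ Part.mem_some_iff.symm
    cases B n <;> simp
  -- Stage `s` answers yes if some segment of the approximate oracle gives output `1` and no shorter
  -- one gives `0`. Once the shortest relevant true segment has settled, a true computation beats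
  -- every longer false one, and shorter segments are genuine.
  refine ⟨fun s n => decide (∃ N < s, D ((n, 1), pre (Z s) N) ∧
    ∀ M < N, ¬ D ((n, 0), pre (Z s) M)), by fun_prop, .of_forall fun n => ?_⟩
  by_cases hn : B n = true
  · obtain ⟨N, hN⟩ := (h1 n).1 hn
    obtain ⟨s₀, hs₀⟩ := lZ N
    refine ⟨max s₀ (N + 1), fun s hs => ?_⟩
    have e := hs₀ s (by omega)
    rw [hn, decide_eq_true_eq]
    refine ⟨N, by omega, by rwa [e], fun M hM hD => ?_⟩
    rw [pre_mono hM.le e] at hD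
    simp [(h0 n).2 ⟨M, hD⟩] at hn
  · have hn' : B n = false := by simpa using hn
    obtain ⟨M, hM⟩ := (h0 n).1 hn'
    obtain ⟨s₀, hs₀⟩ := lZ M
    refine ⟨s₀, fun s hs => ?_⟩
    have e := hs₀ s hs
    rw [hn', decide_eq_false_iff_not]
    rintro ⟨N, -, h, h'⟩
    rcases lt_or_ge M N with hlt | hle
    · exact h' M hlt (by rwa [e])
    · rw [pre_mono hle e] at h
      exact hn ((h1 n).2 ⟨N, h⟩)

end Computability

/-! ### Measures of cylinders -/

theorem measurableSet_cyl (σ : List Bool) : MeasurableSet (cyl σ) := by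
  have : cyl σ = ⋂ (i : ℕ) (h : i < σ.length), (fun X : Cantor => X i) ⁻¹' {σ[i]} := by
    ext X
    simp [cyl]
  rw [this]
  exact MeasurableSet.iInter fun i => MeasurableSet.iInter fun h =>
    measurable_pi_apply i (measurableSet_singleton _)

instance (R : Cantor) (n : ℕ) : IsFiniteMeasure (basicMeasure R n) := by
  refine ⟨?_⟩
  simp only [basicMeasure, Measure.coe_finsetSum, Finset.sum_apply, Measure.smul_apply,
    measure_univ, smul_eq_mul, mul_one]
  exact ENNReal.sum_lt_top.2 fun i _ => ENNReal.pow_lt_top (by simp)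

open Classical in
theorem basicMeasure_real_cyl (R : Cantor) (n : ℕ) (σ : List Bool) :
    (basicMeasure R n).real (cyl σ) =
      ((Finset.range (2 ^ n)).filter fun i => atomOf R n i ∈ cyl σ).card * (1 / 2 : ℝ) ^ n := by
  have h : basicMeasure R n (cyl σ) =
      ((Finset.range (2 ^ n)).filter fun i => atomOf R n i ∈ cyl σ).card * (2 : ℝ≥0∞)⁻¹ ^ n := by
    simp only [basicMeasure, Measure.coe_finsetSum, Finset.sum_apply, Measure.smul_apply,
      smul_eq_mul, Measure.dirac_apply' _ (measurableSet_cyl σ), Set.indicator_apply,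
      Pi.one_apply, mul_ite, mul_one, mul_zero, ← Finset.sum_filter, Finset.sum_const,
      nsmul_eq_mul]
  rw [Measure.real, h]
  simp

theorem abs_sub_le_cylDist (μ ν : Measure Cantor) [IsFiniteMeasure μ] [IsFiniteMeasure ν]
    (σ : List Bool) : |μ.real (cyl σ) - ν.real (cyl σ)| ≤ 2 ^ σ.length * cylDist μ ν := by
  -- Without a bound the real supremum would take the default value `0` and control nothing.
  have hb : BddAbove (Set.range fun σ : List Bool =>
      (1 / 2 : ℝ) ^ σ.length * |μ.real (cyl σ) - ν.real (cyl σ)|) := by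
    refine ⟨μ.real Set.univ + ν.real Set.univ, ?_⟩
    rintro _ ⟨τ, rfl⟩
    have h1 : μ.real (cyl τ) ≤ μ.real Set.univ := measureReal_mono (Set.subset_univ _)
    have h2 : ν.real (cyl τ) ≤ ν.real Set.univ := measureReal_mono (Set.subset_univ _)
    have h3 : 0 ≤ μ.real (cyl τ) := measureReal_nonneg
    have h4 : 0 ≤ ν.real (cyl τ) := measureReal_nonneg
    refine (mul_le_of_le_one_left (abs_nonneg _)
      (pow_le_one₀ (by norm_num) (by norm_num))).trans ?_
    rw [abs_le]
    constructor <;> linarith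
  have h : (1 / 2 : ℝ) ^ σ.length * |μ.real (cyl σ) - ν.real (cyl σ)| ≤ cylDist μ ν :=
    le_ciSup hb σ
  have h2 : (0 : ℝ) < 2 ^ σ.length := by positivity
  calc |μ.real (cyl σ) - ν.real (cyl σ)|
      = 2 ^ σ.length * ((1 / 2 : ℝ) ^ σ.length * |μ.real (cyl σ) - ν.real (cyl σ)|) := by
        rw [← mul_assoc, ← mul_pow]; norm_num
    _ ≤ _ := by gcongr

/-- A position beyond which a representation is not consulted for its `k`-th basic measure. -/
def use (k : ℕ) : ℕ := Nat.pair k (Nat.pair (2 ^ k) k)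

/-- The number of atoms of the `k`-th basic measure coded by a real extending `ρ` that extend
the string `σ`. -/
def atomCount (ρ σ : List Bool) (k : ℕ) : ℕ :=
  ((List.range (2 ^ k)).filter fun i => ∀ j < σ.length,
    (if j < k then ρ.getD (Nat.pair k (Nat.pair i j)) false else false) = σ.getD j false).length

/-- The `k`-th basic measure coded by `R` witnesses that `[σ]` has measure less than `2⁻ⁿ`. -/
def Small (R : Cantor) (σ : List Bool) (n k : ℕ) : Prop :=
  atomCount (pre R (use k)) σ k * 2 ^ n + 2 ^ (σ.length + n) < 2 ^ k

open Classical in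
theorem atomCount_pre (R : Cantor) (σ : List Bool) (k : ℕ) :
    atomCount (pre R (use k)) σ k =
      ((Finset.range (2 ^ k)).filter fun i => atomOf R k i ∈ cyl σ).card := by
  rw [atomCount, ← Finset.card_range (2 ^ k), ← List.toFinset_card_of_nodup
    (List.Nodup.filter _ List.nodup_range), Finset.card_range]
  congr 1
  ext i
  simp only [List.mem_toFinset, List.mem_filter, List.mem_range, decide_eq_true_eq,
    Finset.mem_filter, Finset.mem_range]
  refine and_congr_right fun hi => forall₂_congr fun j hj => ?_
  rw [List.getD_eq_getElem _ _ hj, atomOf]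
  by_cases hjk : j < k
  · have : Nat.pair k (Nat.pair i j) < (pre R (use k)).length := by
      rw [length_pre]
      exact Nat.pair_lt_pair_right _
        ((Nat.pair_lt_pair_left _ hi).trans (Nat.pair_lt_pair_right _ hjk))
    rw [if_pos hjk, if_pos hjk, List.getD_eq_getElem _ _ this, getElem_pre]
  · rw [if_neg hjk, if_neg hjk]

/-- The term `2 ^ σ.length * (1 / 2) ^ k` is the worst error of the `k`-th basic measure on `[σ]`;
multiplying out denominators turns the comparison into one between natural numbers. -/
theorem small_iff (R : Cantor) (σ : List Bool) (n k : ℕ) :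
    Small R σ n k ↔ (basicMeasure R k).real (cyl σ) + 2 ^ σ.length * (1 / 2 : ℝ) ^ k
      < (1 / 2 : ℝ) ^ n := by
  rw [basicMeasure_real_cyl, Small, atomCount_pre]
  generalize (Finset.card _) = c
  rw [← Nat.cast_lt (α := ℝ)]
  push_cast
  rw [one_div, inv_pow, inv_pow, ← add_mul, ← div_eq_mul_inv, div_lt_iff₀ (by positivity),
    inv_mul_eq_div, lt_div_iff₀ (by positivity), pow_add, add_mul]

/-- The error bound makes every witness sound, and since it tends to `0` in `k`, any strict
inequality is eventually witnessed. The right side does not depend on `R`. -/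
theorem Represents.exists_small_iff {R : Cantor} {μ : ProbabilityMeasure Cantor}
    (hR : Represents R μ) (σ : List Bool) (n : ℕ) :
    (∃ k, Small R σ n k) ↔ (μ : Measure Cantor).real (cyl σ) < (1 / 2 : ℝ) ^ n := by
  have hd : ∀ k, |(basicMeasure R k).real (cyl σ) - (μ : Measure Cantor).real (cyl σ)| ≤
      2 ^ σ.length * (1 / 2 : ℝ) ^ k := fun k =>
    (abs_sub_le_cylDist _ _ σ).trans (by gcongr; exact hR k)
  constructor
  · rintro ⟨k, hk⟩
    rw [small_iff] at hk
    have := abs_le.1 (hd k)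
    linarith
  · intro h
    have ht : Filter.Tendsto (fun k : ℕ => 2 * 2 ^ σ.length * (1 / 2 : ℝ) ^ k) Filter.atTop
        (nhds (2 * 2 ^ σ.length * 0)) :=
      (tendsto_pow_atTop_nhds_zero_of_lt_one (by norm_num) (by norm_num)).const_mul _
    rw [mul_zero] at ht
    obtain ⟨k, hk⟩ := (ht.eventually_lt_const (sub_pos.2 h)).exists
    refine ⟨k, (small_iff _ _ _ _).2 ?_⟩
    have := abs_le.1 (hd k)
    linarith

theorem measure_le_of_real_lt {μ : Measure Cantor} [IsFiniteMeasure μ] {s : Set Cantor} {n : ℕ}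
    (h : μ.real s < (1 / 2 : ℝ) ^ n) : μ s ≤ (2 : ℝ≥0∞)⁻¹ ^ n := by
  rw [← ofReal_measureReal (measure_ne_top μ s)]
  refine (ENNReal.ofReal_le_ofReal h.le).trans_eq ?_
  rw [ENNReal.ofReal_pow (by norm_num), one_div, ENNReal.ofReal_inv_of_pos (by norm_num)]
  norm_num

/-- The cylinders of the initial segments decrease to `{X}`, so continuity from above applies. -/
theorem exists_cyl_pre_lt {μ : Measure Cantor} [IsFiniteMeasure μ] {X : Cantor} (h : μ {X} = 0)
    (n : ℕ) : ∃ l, μ.real (cyl (pre X l)) < (1 / 2 : ℝ) ^ n := by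
  have hi : ⋂ l, cyl (pre X l) = {X} := by
    ext Y
    simp only [Set.mem_iInter, Set.mem_singleton_iff, mem_cyl_pre]
    constructor
    · intro hY
      funext i
      exact pre_eq_pre_iff.1 (hY (i + 1)) i (Nat.lt_succ_self i)
    · rintro rfl l
      rfl
  have ht := tendsto_measure_iInter_atTop (μ := μ) (s := fun l => cyl (pre X l))
    (fun l => (measurableSet_cyl _).nullMeasurableSet)
    (fun l m hlm Y hY => mem_cyl_pre.2 (pre_mono hlm (mem_cyl_pre.1 hY)))
    ⟨0, measure_ne_top _ _⟩
  rw [hi, h] at ht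
  have ht' := (ENNReal.tendsto_toReal ENNReal.zero_ne_top).comp ht
  exact (ht'.eventually_lt_const (show (0 : ℝ≥0∞).toReal < (1 / 2 : ℝ) ^ n by simp)).exists

/-! ### Decidability of `Small` from a representation -/

section Small

variable {α : Type*} [Primcodable α] {Z R : Cantor} {f : α → List Bool} {g h : α → ℕ}

@[fun_prop] theorem primrec_use (hg : Primrec g) : Primrec fun a => use (g a) := by
  unfold use; fun_prop

@[fun_prop] theorem primrec_atomCount {ρ : α → List Bool} (hρ : Primrec ρ) (hf : Primrec f)
    (hg : Primrec g) : Primrec fun a => atomCount (ρ a) (f a) (g a) := by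
  unfold atomCount; fun_prop

/-- The length of the segment of `R` consulted is known in advance, so the segment can be guessed
and checked. This gives both `Small` and its negation. -/
theorem Sigma01.of_pre_use {p : α → List Bool → Prop}
    (hR : Sigma01 Z (fun x : ℕ × Bool => R x.1 = x.2))
    (hp : PrimrecPred fun x : α × List Bool => p x.1 x.2) (hg : Primrec g) :
    Sigma01 Z fun a => p a (pre R (use (g a))) := by
  have h : Sigma01 Z fun a => ∃ ρ : List Bool, pre R ρ.length = ρ ∧ ρ.length = use (g a) ∧ p a ρ :=
    Sigma01.exists' <| ((Sigma01.eq_pre hR).comp (f := fun x : α × List Bool => x.2)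
      (by fun_prop)).and (by fun_prop)
  refine h.of_iff fun a => ⟨fun ha => ⟨_, by simp, by simp, ha⟩, ?_⟩
  rintro ⟨ρ, h1, h2, h3⟩
  rwa [← h2, h1]

theorem Sigma01.small (hR : Sigma01 Z (fun x : ℕ × Bool => R x.1 = x.2)) (hf : Primrec f)
    (hg : Primrec g) (hh : Primrec h) : Sigma01 Z fun a => Small R (f a) (g a) (h a) :=
  Sigma01.of_pre_use (p := fun a ρ =>
    atomCount ρ (f a) (h a) * 2 ^ g a + 2 ^ ((f a).length + g a) < 2 ^ h a) hR (by fun_prop) hh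

theorem Sigma01.not_small (hR : Sigma01 Z (fun x : ℕ × Bool => R x.1 = x.2)) (hf : Primrec f)
    (hg : Primrec g) (hh : Primrec h) : Sigma01 Z fun a => ¬ Small R (f a) (g a) (h a) :=
  Sigma01.of_pre_use (p := fun a ρ =>
    ¬ atomCount ρ (f a) (h a) * 2 ^ g a + 2 ^ ((f a).length + g a) < 2 ^ h a) hR (by fun_prop) hh

end Small

/-! ### Tests with uniformly small sections -/

/-- The open subset of `2^ω × 2^ω` given by a set of pairs of strings. -/
def box (W : Set (List Bool × List Bool)) : Set (Cantor × Cantor) := ⋃ s ∈ W, cyl s.1 ×ˢ cyl s.2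

theorem mem_box {W : Set (List Bool × List Bool)} {X Y : Cantor} :
    (X, Y) ∈ box W ↔ ∃ i j, (pre X i, pre Y j) ∈ W := by
  simp only [box, Set.mem_iUnion, Set.mem_prod, Prod.exists, exists_prop]
  constructor
  · rintro ⟨ρ, σ, h, h1, h2⟩
    exact ⟨ρ.length, σ.length, by rwa [mem_cyl_iff.1 h1, mem_cyl_iff.1 h2]⟩
  · rintro ⟨i, j, h⟩
    exact ⟨_, _, h, mem_cyl_pre.2 rfl, mem_cyl_pre.2 rfl⟩

theorem measurableSet_box (W : Set (List Bool × List Bool)) : MeasurableSet (box W) :=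
  MeasurableSet.biUnion W.to_countable fun _ _ =>
    (measurableSet_cyl _).prod (measurableSet_cyl _)

section Tests

variable {μ : ProbabilityMeasure Cantor} {A B : Cantor}
  {W : Cantor → ℕ → Set (List Bool × List Bool)}

theorem lintegral_le_of_forall_le {μ : Measure Cantor} [IsProbabilityMeasure μ] {f : Cantor → ℝ≥0∞}
    {c : ℝ≥0∞} (h : ∀ x, f x ≤ c) : ∫⁻ x, f x ∂μ ≤ c :=
  (lintegral_mono h).trans (by simp)

/-- One set of pairs serves both claims: Fubini bounds its product measure by the section bound, and
its section at `B` is a test relative to `B`. -/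
theorem not_random_of_left_sections
    (hS : ∀ R Z, Sigma01 Z (fun x : ℕ × Bool => R x.1 = x.2) →
      Sigma01 Z fun p : ℕ × (List Bool × List Bool) => p.2 ∈ W R p.1)
    (hm : ∀ R, Represents R μ → ∀ n Y,
      (μ : Measure Cantor) {X | (X, Y) ∈ box (W R n)} ≤ (2 : ℝ≥0∞)⁻¹ ^ n)
    (hAB : ∀ R, Represents R μ → ∀ n, (A, B) ∈ box (W R n)) :
    (A, B) ∉ MLRPair μ ∧ A ∉ MLR μ B := by
  constructor
  · rintro ⟨R, hR, h⟩
    refine h (fun n => box (W R n)) ⟨⟨W R, (hS R _ (.eq_bit_join_left R _)).rePredIn,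
      fun n => rfl⟩, fun n => ?_⟩ (Set.mem_iInter.2 (hAB R hR))
    rw [Measure.prod_apply_symm (measurableSet_box _)]
    exact lintegral_le_of_forall_le (hm R hR n)
  · rintro ⟨R, hR, h⟩
    refine h (fun n => {X | (X, B) ∈ box (W R n)})
      ⟨⟨fun n => {ρ | ∃ σ : List Bool, pre B σ.length = σ ∧ (ρ, σ) ∈ W R n}, ?_, fun n => ?_⟩,
        fun n => hm R hR n B⟩ (Set.mem_iInter.2 (hAB R hR))
    · refine Sigma01.rePredIn (Sigma01.exists' (Sigma01.and ?_ ?_))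
      · exact (Sigma01.eq_pre (.eq_bit_join_right R B)).comp (by fun_prop)
      · exact (hS R _ (.eq_bit_join_left R B)).comp
          (f := fun x : (ℕ × List Bool) × List Bool => (x.1.1, (x.1.2, x.2))) (by fun_prop)
    · ext X
      simp only [Set.mem_ofPred_eq, mem_box, Set.mem_iUnion, exists_prop]
      constructor
      · rintro ⟨i, j, h⟩
        exact ⟨_, ⟨_, by simp, h⟩, mem_cyl_pre.2 rfl⟩
      · rintro ⟨ρ, ⟨σ, hσ, h⟩, hX⟩
        exact ⟨ρ.length, σ.length, by rwa [hσ, mem_cyl_iff.1 hX]⟩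

theorem not_random_of_right_sections
    (hS : ∀ R Z, Sigma01 Z (fun x : ℕ × Bool => R x.1 = x.2) →
      Sigma01 Z fun p : ℕ × (List Bool × List Bool) => p.2 ∈ W R p.1)
    (hm : ∀ R, Represents R μ → ∀ n X,
      (μ : Measure Cantor) {Y | (X, Y) ∈ box (W R n)} ≤ (2 : ℝ≥0∞)⁻¹ ^ n)
    (hAB : ∀ R, Represents R μ → ∀ n, (A, B) ∈ box (W R n)) :
    (A, B) ∉ MLRPair μ ∧ B ∉ MLR μ A := by
  constructor
  · rintro ⟨R, hR, h⟩
    refine h (fun n => box (W R n)) ⟨⟨W R, (hS R _ (.eq_bit_join_left R _)).rePredIn,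
      fun n => rfl⟩, fun n => ?_⟩ (Set.mem_iInter.2 (hAB R hR))
    rw [Measure.prod_apply (measurableSet_box _)]
    exact lintegral_le_of_forall_le (hm R hR n)
  · rintro ⟨R, hR, h⟩
    refine h (fun n => {Y | (A, Y) ∈ box (W R n)})
      ⟨⟨fun n => {σ | ∃ ρ : List Bool, pre A ρ.length = ρ ∧ (ρ, σ) ∈ W R n}, ?_, fun n => ?_⟩,
        fun n => hm R hR n A⟩ (Set.mem_iInter.2 (hAB R hR))
    · refine Sigma01.rePredIn (Sigma01.exists' (Sigma01.and ?_ ?_))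
      · exact (Sigma01.eq_pre (.eq_bit_join_right R A)).comp (by fun_prop)
      · exact (hS R _ (.eq_bit_join_left R A)).comp
          (f := fun x : (ℕ × List Bool) × List Bool => (x.1.1, (x.2, x.1.2))) (by fun_prop)
    · ext Y
      simp only [Set.mem_ofPred_eq, mem_box, Set.mem_iUnion, exists_prop]
      constructor
      · rintro ⟨i, j, h⟩
        exact ⟨_, ⟨_, by simp, h⟩, mem_cyl_pre.2 rfl⟩
      · rintro ⟨σ, ⟨ρ, hρ, h⟩, hY⟩
        exact ⟨ρ.length, σ.length, by rwa [hρ, mem_cyl_iff.1 hY]⟩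

end Tests

/-! ### The test that predicts an approximated real from the other one -/

/-- `s` is the first stage from `n` on at which the approximation agrees with `σ` up to `n`. -/
def FirstStage (Bs : ℕ → Cantor) (n : ℕ) (σ : List Bool) (s : ℕ) : Prop :=
  n ≤ s ∧ pre (Bs s) n = σ ∧ ∀ t < s, n ≤ t → pre (Bs t) n ≠ σ

theorem FirstStage.unique {Bs : ℕ → Cantor} {n : ℕ} {σ : List Bool} {s t : ℕ}
    (hs : FirstStage Bs n σ s) (ht : FirstStage Bs n σ t) : s = t := by
  rcases lt_trichotomy s t with h | h | h
  · exact absurd hs.2.1 (ht.2.2 s h hs.1)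
  · exact h
  · exact absurd ht.2.1 (hs.2.2 t h ht.1)

theorem ConvergesTo.exists_firstStage {Bs : ℕ → Cantor} {B : Cantor} (h : ConvergesTo Bs B)
    (n : ℕ) : ∃ s, FirstStage Bs n (pre B n) s := by
  classical
  obtain ⟨s₀, h₀⟩ := h n
  have hex : ∃ s, n ≤ s ∧ pre (Bs s) n = pre B n :=
    ⟨max n s₀, le_max_left _ _, h₀ _ (le_max_right _ _)⟩
  exact ⟨Nat.find hex, (Nat.find_spec hex).1, (Nat.find_spec hex).2,
    fun t ht hn he => Nat.find_min hex ht ⟨hn, he⟩⟩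

/-- Pairs `(ρ, σ)` such that `ρ` is a string of small measure that agrees with the approximation
`As` at the first stage at which `Bs` agrees with `σ`. -/
def stageTest (As Bs : ℕ → Cantor) (R : Cantor) (N : ℕ) : Set (List Bool × List Bool) :=
  {p | N < p.2.length ∧ (∃ s, FirstStage Bs p.2.length p.2 s ∧ pre (As s) p.1.length = p.1) ∧
    ∃ k, Small R p.1 p.2.length k}

theorem sigma01_stageTest {As Bs : ℕ → Cantor} (hAs : Primrec fun p : ℕ × ℕ => As p.1 p.2)
    (hBs : Primrec fun p : ℕ × ℕ => Bs p.1 p.2) (R Z : Cantor)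
    (hR : Sigma01 Z (fun x : ℕ × Bool => R x.1 = x.2)) :
    Sigma01 Z fun p : ℕ × (List Bool × List Bool) => p.2 ∈ stageTest As Bs R p.1 := by
  unfold stageTest FirstStage
  refine Sigma01.and (by fun_prop) (Sigma01.and (by fun_prop) (Sigma01.exists_nat ?_))
  exact Sigma01.small hR (by fun_prop) (by fun_prop) (by fun_prop)

/-- For each `n > N`, `Y` determines at most one first stage, hence one real `As s`; every string
listed for `n` extends its shortest initial segment of measure below `2⁻ⁿ`. Summing over `n > N`
gives `2⁻ᴺ`. -/
theorem measure_stageTest_section_le {μ : ProbabilityMeasure Cantor} {R : Cantor}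
    (hR : Represents R μ) (As Bs : ℕ → Cantor) (N : ℕ) (Y : Cantor) :
    (μ : Measure Cantor) {X | (X, Y) ∈ box (stageTest As Bs R N)} ≤ (2 : ℝ≥0∞)⁻¹ ^ N := by
  classical
  have hsub : {X | (X, Y) ∈ box (stageTest As Bs R N)} ⊆
      ⋃ i : ℕ, {X | ∃ l, (pre X l, pre Y (N + 1 + i)) ∈ stageTest As Bs R N} := by
    intro X hX
    obtain ⟨l, j, h⟩ := mem_box.1 hX
    have hj : N < j := by simpa using h.1
    obtain ⟨i, rfl⟩ := Nat.exists_eq_add_of_le (Nat.succ_le_of_lt hj)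
    exact Set.mem_iUnion.2 ⟨i, l, h⟩
  have hle : ∀ n, (μ : Measure Cantor) {X | ∃ l, (pre X l, pre Y n) ∈ stageTest As Bs R N} ≤
      (2 : ℝ≥0∞)⁻¹ ^ n := by
    intro n
    by_cases hex : ∃ s, FirstStage Bs n (pre Y n) s ∧
      ∃ l, (μ : Measure Cantor).real (cyl (pre (As s) l)) < (1 / 2 : ℝ) ^ n
    · obtain ⟨s, hs, hl⟩ := hex
      refine (measure_mono ?_).trans (measure_le_of_real_lt (Nat.find_spec hl))
      rintro X ⟨l, -, ⟨t, ht, hX⟩, hk⟩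
      simp only [length_pre] at ht hX hk
      obtain rfl := hs.unique ht
      rw [hR.exists_small_iff, ← hX] at hk
      exact mem_cyl_pre.2 (pre_mono (Nat.find_min' hl hk) hX.symm)
    · refine (measure_mono (t := ∅) ?_).trans (by simp)
      rintro X ⟨l, -, ⟨t, ht, hX⟩, hk⟩
      simp only [length_pre] at ht hX hk
      rw [hR.exists_small_iff, ← hX] at hk
      exact hex ⟨t, ht, l, hk⟩
  calc (μ : Measure Cantor) {X | (X, Y) ∈ box (stageTest As Bs R N)}
      ≤ ∑' i : ℕ, (2 : ℝ≥0∞)⁻¹ ^ (N + 1 + i) :=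
        (measure_mono hsub).trans ((measure_iUnion_le _).trans (ENNReal.tsum_le_tsum fun i => hle _))
    _ = (2 : ℝ≥0∞)⁻¹ ^ N := by
        simp_rw [pow_add, ENNReal.tsum_mul_left, ENNReal.tsum_geometric, pow_one,
          ENNReal.one_sub_inv_two, inv_inv, mul_assoc]
        rw [ENNReal.inv_mul_cancel (by simp) (by simp), mul_one]

/-! ### The test given by the least witness -/

/-- Pairs `(ρ, σ)` such that for the least `w` for which `good w` holds and `ρ` extends `a w`,
`σ` is the string `b w`. -/
def leastWitnessTest (good : ℕ → Prop) (a b : ℕ → List Bool) : Set (List Bool × List Bool) :=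
  {p | ∃ w, good w ∧ p.1.take (a w).length = a w ∧ p.2 = b w ∧
    ∀ v < w, ¬ good v ∨ (a v).length ≤ p.1.length ∧ ¬ p.1.take (a v).length = a v}

/-- Only the least good `w` with `X` extending `a w` contributes, so the section lies in the single
cylinder of `b w`. -/
theorem measure_leastWitnessTest_section_le {μ : Measure Cantor} {good : ℕ → Prop}
    {a b : ℕ → List Bool} {c : ℝ≥0∞} (h : ∀ w, good w → μ (cyl (b w)) ≤ c) (X : Cantor) :
    μ {Y | (X, Y) ∈ box (leastWitnessTest good a b)} ≤ c := by
  classical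
  by_cases hex : ∃ w, good w ∧ X ∈ cyl (a w)
  · refine (measure_mono ?_).trans (h _ (Nat.find_spec hex).1)
    intro Y hY
    obtain ⟨i, j, w, hg, ha, hb, hv⟩ := mem_box.1 hY
    simp only at ha hb hv
    have hlen : (a w).length ≤ i := by
      have := congrArg List.length ha
      simp only [List.length_take, length_pre] at this
      omega
    rw [take_pre _ hlen] at ha
    have hw : Nat.find hex = w := by
      refine le_antisymm (Nat.find_min' hex ⟨hg, mem_cyl_iff.2 ha⟩) (not_lt.1 fun hlt => ?_)
      obtain ⟨h1, h2⟩ := Nat.find_spec hex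
      rcases hv _ hlt with h3 | ⟨h3, h4⟩
      · exact h3 h1
      · rw [length_pre] at h3
        rw [take_pre _ h3] at h4
        exact h4 (mem_cyl_iff.1 h2)
    rw [hw, ← hb]
    exact mem_cyl_pre.2 rfl
  · refine (measure_mono (t := ∅) ?_).trans (by simp)
    intro Y hY
    obtain ⟨i, j, w, hg, ha, hb, hv⟩ := mem_box.1 hY
    simp only at ha
    have hlen : (a w).length ≤ i := by
      have := congrArg List.length ha
      simp only [List.length_take, length_pre] at this
      omega
    rw [take_pre _ hlen] at ha
    exact hex ⟨w, hg, mem_cyl_iff.2 ha⟩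

theorem mem_box_leastWitnessTest {good : ℕ → Prop} {a b : ℕ → List Bool} {X Y : Cantor}
    (hex : ∃ w, good w ∧ X ∈ cyl (a w)) (h : ∀ w, good w → X ∈ cyl (a w) → Y ∈ cyl (b w)) :
    (X, Y) ∈ box (leastWitnessTest good a b) := by
  classical
  obtain ⟨hg, ha⟩ := Nat.find_spec hex
  set w := Nat.find hex
  -- Long enough for the initial segment of `X` to settle compatibility with every `a v`, `v ≤ w`.
  set i := (Finset.range (w + 1)).sup fun v => (a v).length
  have hi : ∀ v ≤ w, (a v).length ≤ i := fun v hv =>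
    Finset.le_sup (f := fun v => (a v).length) (Finset.mem_range.2 (Nat.lt_succ_of_le hv))
  refine mem_box.2 ⟨i, (b w).length, w, hg, ?_, mem_cyl_iff.1 (h w hg ha), fun v hv => ?_⟩
  · simp only
    rw [take_pre _ (hi w le_rfl)]
    exact mem_cyl_iff.1 ha
  · by_cases hgv : good v
    · refine Or.inr ⟨by simpa using hi v hv.le, ?_⟩
      simp only
      rw [take_pre _ (hi v hv.le), ← mem_cyl_iff]
      exact fun hX => Nat.find_min hex hv ⟨hgv, hX⟩
    · exact Or.inl hgv

/-- Leastness refutes earlier witnesses, so goodness must be decidable in the oracle. This is why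
guesses carry the witnesses `k` and `k'` for smallness. -/
theorem sigma01_leastWitnessTest {Z : Cantor} {good : ℕ → ℕ → Prop} {a b : ℕ → List Bool}
    (hg : Sigma01 Z fun p : ℕ × ℕ => good p.1 p.2)
    (hng : Sigma01 Z fun p : ℕ × ℕ => ¬ good p.1 p.2) (ha : Primrec a) (hb : Primrec b) :
    Sigma01 Z fun p : ℕ × (List Bool × List Bool) => p.2 ∈ leastWitnessTest (good p.1) a b := by
  unfold leastWitnessTest
  refine Sigma01.exists_nat (Sigma01.and ?_ (Sigma01.and (by fun_prop) (Sigma01.and (by fun_prop)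
    (Sigma01.ball (Sigma01.or ?_ (Sigma01.of_primrecPred (by fun_prop))) (by fun_prop)))))
  · exact hg.comp (f := fun x : (ℕ × List Bool × List Bool) × ℕ => (x.1.1, x.2)) (by fun_prop)
  · exact hng.comp (f := fun x : ((ℕ × List Bool × List Bool) × ℕ) × ℕ => (x.1.1.1, x.2))
      (by fun_prop)

/-! ### The test that bounds the stages of one approximation by those of the other -/

/-! A guess is the number `w` of a sextuple `(m, s, l, j, k, k')`.  It stands for the claim that the
approximation `As` at stage `s` up to `l` is a string of measure less than `2⁻ᵐ`, while `Bs` up to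
`j` does not change between the stages `m` and `s`. -/

namespace Guess

/-- The part of the code of a list that remains when `i` entries are dropped. -/
def tail (i w : ℕ) : ℕ := (fun v => v.unpair.2)^[i] w

theorem primrec_tail (i : ℕ) : Primrec (tail i) := by
  induction i with
  | zero => exact Primrec.id
  | succ i ih => exact ih.comp (Primrec.snd.comp Primrec.unpair)

/-- The entry `m` of a guess. -/
def m (w : ℕ) : ℕ := (tail 0 w).unpair.1

/-- The entry `s` of a guess. -/
def s (w : ℕ) : ℕ := (tail 1 w).unpair.1

/-- The entry `l` of a guess. -/
def l (w : ℕ) : ℕ := (tail 2 w).unpair.1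

/-- The entry `j` of a guess. -/
def j (w : ℕ) : ℕ := (tail 3 w).unpair.1

/-- The entry `k` of a guess. -/
def k (w : ℕ) : ℕ := (tail 4 w).unpair.1

/-- The entry `k'` of a guess. -/
def k' (w : ℕ) : ℕ := tail 5 w

@[fun_prop] theorem primrec_m : Primrec m := Primrec.fst.comp (Primrec.unpair.comp (primrec_tail 0))

@[fun_prop] theorem primrec_s : Primrec s := Primrec.fst.comp (Primrec.unpair.comp (primrec_tail 1))

@[fun_prop] theorem primrec_l : Primrec l := Primrec.fst.comp (Primrec.unpair.comp (primrec_tail 2))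

@[fun_prop] theorem primrec_j : Primrec j := Primrec.fst.comp (Primrec.unpair.comp (primrec_tail 3))

@[fun_prop] theorem primrec_k : Primrec k := Primrec.fst.comp (Primrec.unpair.comp (primrec_tail 4))

@[fun_prop] theorem primrec_k' : Primrec k' := primrec_tail 5

theorem exists_eq (a b c d e f : ℕ) :
    ∃ w, m w = a ∧ s w = b ∧ l w = c ∧ j w = d ∧ k w = e ∧ k' w = f :=
  ⟨Nat.pair a (Nat.pair b (Nat.pair c (Nat.pair d (Nat.pair e f)))), by
    simp [m, s, l, j, k, k', tail]⟩

/-- The guess `w`, with `N < m`, is verified, and the string that it predicts has measure less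
than `2⁻ⁿ`. -/
def Good (As Bs : ℕ → Cantor) (N : ℕ) (R : Cantor) (n w : ℕ) : Prop :=
  (N < m w ∧ j w ≤ m w ∧ ∀ t < s w, m w ≤ t → pre (Bs t) (j w) = pre (Bs (m w)) (j w)) ∧
    Small R (pre (As (s w)) (l w)) (m w) (k w) ∧ Small R (pre (Bs (m w)) (j w)) n (k' w)

end Guess

/-- The test given by the least verified guess. -/
def guessTest (As Bs : ℕ → Cantor) (N : ℕ) (R : Cantor) (n : ℕ) : Set (List Bool × List Bool) :=
  leastWitnessTest (fun w => Guess.Good As Bs N R n w)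
    (fun w => pre (As (Guess.s w)) (Guess.l w))
    (fun w => pre (Bs (Guess.m w)) (Guess.j w))

theorem sigma01_guessTest {As Bs : ℕ → Cantor} (hAs : Primrec fun p : ℕ × ℕ => As p.1 p.2)
    (hBs : Primrec fun p : ℕ × ℕ => Bs p.1 p.2) (N : ℕ) (R Z : Cantor)
    (hR : Sigma01 Z (fun x : ℕ × Bool => R x.1 = x.2)) :
    Sigma01 Z fun p : ℕ × (List Bool × List Bool) => p.2 ∈ guessTest As Bs N R p.1 := by
  refine sigma01_leastWitnessTest (good := fun n w => Guess.Good As Bs N R n w)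
    ?_ ?_ (by fun_prop) (by fun_prop)
  · unfold Guess.Good
    refine Sigma01.and (by fun_prop) (Sigma01.and (Sigma01.small hR ?_ ?_ ?_)
      (Sigma01.small hR ?_ ?_ ?_)) <;> fun_prop
  · have h : PrimrecPred fun p : ℕ × ℕ => N < Guess.m p.2 ∧ Guess.j p.2 ≤ Guess.m p.2 ∧
        ∀ t < Guess.s p.2, Guess.m p.2 ≤ t →
          pre (Bs t) (Guess.j p.2) = pre (Bs (Guess.m p.2)) (Guess.j p.2) := by fun_prop
    refine Sigma01.of_iff (Sigma01.or (Sigma01.of_primrecPred h.not) (Sigma01.or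
      (Sigma01.not_small hR (f := fun p : ℕ × ℕ => pre (As (Guess.s p.2)) (Guess.l p.2))
        (g := fun p => Guess.m p.2) (h := fun p => Guess.k p.2) ?_ ?_ ?_)
      (Sigma01.not_small hR (f := fun p : ℕ × ℕ => pre (Bs (Guess.m p.2)) (Guess.j p.2))
        (g := fun p => p.1) (h := fun p => Guess.k' p.2) ?_ ?_ ?_))) fun p => ?_
    on_goal 7 => exact not_and_or.trans (or_congr_right not_and_or)
    all_goals fun_prop

theorem measure_guessTest_section_le {μ : ProbabilityMeasure Cantor} {R : Cantor}
    (hR : Represents R μ) (As Bs : ℕ → Cantor) (N n : ℕ) (X : Cantor) :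
    (μ : Measure Cantor) {Y | (X, Y) ∈ box (guessTest As Bs N R n)} ≤ (2 : ℝ≥0∞)⁻¹ ^ n :=
  measure_leastWitnessTest_section_le
    (fun _ h => measure_le_of_real_lt ((hR.exists_small_iff _ _).1 ⟨_, h.2.2⟩)) X

/-! ### The dichotomy between the two tests -/

section Main

variable {μ : ProbabilityMeasure Cantor} {A B : Cantor} {As Bs : ℕ → Cantor}

/-- For infinitely many `n`, the approximation to `A` is already correct on a string of measure
less than `2⁻ⁿ` at the first stage from `n` on at which the approximation to `B` is correct
up to `n`. -/
def SettlesFirst (μ : ProbabilityMeasure Cantor) (A B : Cantor) (As Bs : ℕ → Cantor) : Prop :=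
  ∀ N, ∃ n > N, ∃ s l, FirstStage Bs n (pre B n) s ∧ pre (As s) l = pre A l ∧
    (μ : Measure Cantor).real (cyl (pre A l)) < (1 / 2 : ℝ) ^ n

theorem SettlesFirst.mem_box {R : Cantor} (hR : Represents R μ) (h : SettlesFirst μ A B As Bs)
    (N : ℕ) : (A, B) ∈ box (stageTest As Bs R N) := by
  obtain ⟨n, hn, s, l, hs, hl, hμ⟩ := h N
  refine IndepSpec.mem_box.2 ⟨l, n, by simpa using hn, ⟨s, by simpa using hs, by simpa using hl⟩, ?_⟩
  simpa only [length_pre] using (hR.exists_small_iff _ _).2 hμ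

/-- When `SettlesFirst` fails beyond `N`, every verified guess compatible with `A` predicts `B`
correctly, and since neither real is an atom such guesses exist at every precision `n`. -/
theorem exists_mem_box_guessTest (lA : ConvergesTo As A) (lB : ConvergesTo Bs B)
    (mA : ∀ s t n, s ≤ t → As s n = true → As t n = true)
    (sA : ∀ s n, As s n = true → A n = true)
    (hμA : (μ : Measure Cantor) {A} = 0) (hμB : (μ : Measure Cantor) {B} = 0)
    (h : ¬ SettlesFirst μ A B As Bs) :
    ∃ N, ∀ R, Represents R μ → ∀ n, (A, B) ∈ box (guessTest As Bs N R n) := by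
  simp only [SettlesFirst, not_forall, not_exists, not_and] at h
  obtain ⟨N, hN⟩ := h
  refine ⟨N, fun R hR n => mem_box_leastWitnessTest ?_ fun w hg hA => ?_⟩
  · obtain ⟨j, hj⟩ := exists_cyl_pre_lt hμB n
    obtain ⟨k', hk'⟩ := (hR.exists_small_iff _ _).2 hj
    obtain ⟨s₀, h₀⟩ := lB j
    -- From stage `s₀` on `Bs` is correct up to `j`, so with this `m` the guess is verified whatever
    -- `s` turns out to be.
    obtain ⟨m, hm⟩ : ∃ m, m = max (N + 1) (max j s₀) := ⟨_, rfl⟩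
    obtain ⟨l, hl⟩ := exists_cyl_pre_lt hμA m
    obtain ⟨k, hk⟩ := (hR.exists_small_iff _ _).2 hl
    obtain ⟨s, hs⟩ := lA l
    have hs := hs s le_rfl
    obtain ⟨w, e₁, e₂, e₃, e₄, e₅, e₆⟩ := Guess.exists_eq m s l j k k'
    refine ⟨w, ?_, ?_⟩
    · rw [Guess.Good, e₁, e₂, e₃, e₄, e₅, e₆]
      have hBm := h₀ m (by omega)
      refine ⟨⟨by omega, by omega, fun t _ ht => ?_⟩, by rwa [hs], by rwa [hBm]⟩
      rw [hBm, h₀ t (by omega)]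
    · rw [e₂, e₃]
      exact mem_cyl_pre.2 hs.symm
  · obtain ⟨⟨hNm, hjm, ht⟩, hs, -⟩ := hg
    rw [mem_cyl_pre] at hA ⊢
    have hμ := (hR.exists_small_iff _ _).1 ⟨_, hs⟩
    rw [← hA] at hμ
    obtain ⟨c, hc⟩ := lB.exists_firstStage (Guess.m w)
    -- If `s ≤ c`, then `As c` lies between `As s` and `A`, which agree up to `l`; so stage `c`
    -- would already be correct on a string of measure below `2⁻ᵐ`, against the choice of `N`.
    have hcs : c < (Guess.s w) := by
      by_contra hcs
      refine hN (Guess.m w) hNm c (Guess.l w) hc (pre_eq_pre_iff.2 fun i hi => ?_) hμ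
      have e := pre_eq_pre_iff.1 hA i hi
      rw [Bool.eq_iff_iff]
      exact ⟨sA c i, fun hi => mA _ _ _ (not_lt.1 hcs) (e ▸ hi)⟩
    -- Stage `c` lies between `m` and `s`, where `Bs` up to `j` is constant, and `Bs c` is correct
    -- up to `m ≥ j`.
    rw [← ht c hcs hc.1]
    exact (pre_mono hjm hc.2.1).symm

end Main

end IndepSpec

end

theorem mainTheorem5 (A B : IndepSpec.Cantor) (hA : IndepSpec.IsRE A)
    (hB : IndepSpec.TuringLE B IndepSpec.zeroJump) :
    B ∉ IndepSpec.independenceSpectrum A ∧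
      ¬ ∃ μ : MeasureTheory.ProbabilityMeasure IndepSpec.Cantor,
        IndepSpec.RelativelyRandom μ A B ∧
          (μ : MeasureTheory.Measure IndepSpec.Cantor) {A, B} = 0 := by
  obtain ⟨As, hAs, lA, mA, sA⟩ := hA.exists_approximation
  obtain ⟨Bs, hBs, lB⟩ := hB.exists_approximation
  have key : ∀ μ : MeasureTheory.ProbabilityMeasure IndepSpec.Cantor,
      (μ : MeasureTheory.Measure IndepSpec.Cantor) {A, B} = 0 →
      (A, B) ∉ IndepSpec.MLRPair μ ∧ ¬ IndepSpec.RelativelyRandom μ A B := by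
    intro μ hμ
    -- The first case shows that `A` is not random relative to `B`, the second that `B` is not
    -- random relative to `A`; each also defeats the pair.
    by_cases h : IndepSpec.SettlesFirst μ A B As Bs
    · have := IndepSpec.not_random_of_left_sections (IndepSpec.sigma01_stageTest hAs hBs)
        (fun R hR => IndepSpec.measure_stageTest_section_le hR As Bs) fun R hR => h.mem_box hR
      exact ⟨this.1, fun hr => this.2 hr.1⟩
    · obtain ⟨N, hN⟩ := IndepSpec.exists_mem_box_guessTest lA lB mA sA
        (MeasureTheory.measure_mono_null (by simp) hμ)
        (MeasureTheory.measure_mono_null (by simp) hμ) h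
      have := IndepSpec.not_random_of_right_sections (IndepSpec.sigma01_guessTest hAs hBs N)
        (fun R hR => IndepSpec.measure_guessTest_section_le hR As Bs N) hN
      exact ⟨this.1, fun hr => this.2 hr.2⟩
  exact ⟨fun ⟨μ, h, hμ⟩ => (key μ hμ).1 h, fun ⟨μ, h, hμ⟩ => (key μ hμ).2 h⟩
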